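/- For a finite simple graph $G$ let $P_G(X)\in\mathbb{Z}[X]$ be its chromatic polynomial, the unique polynomial whose value at every natural number $q$ is the number of proper vertex colourings of $G$ with $q$ colours. A complex number $z$ with $P_G(z)=0$ is a chromatic root of $G$; a complex number is called a chromatic root if it is a chromatic root of some finite simple graph. For integers $m_1,\dots,m_n\ge 1$ the generalised theta graph $\Theta_{m_1,\dots,m_n}$ consists of two distinct vertices joined by $n$ otherwise disjoint paths of lengths (numbers of edges) $m_1,\dots,m_n$; it is regarded as a simple graph, so several paths of length $1$ give a single edge. Proposition. If $\alpha\in\mathbb{C}\setminus\mathbb{Z}$ is a chromatic root of a generalised theta graph, then $p\alpha$ is a chromatic root for every natural number $p$. -/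

import Mathlib

/-- For a finite simple graph `G` there is a unique integer polynomial whose value at every
natural number `q` is the number of proper vertex colourings of `G` with `q` colours. -/
theorem SimpleGraph.existsUnique_chromaticPolynomial {V : Type*} [Finite V]
    (G : SimpleGraph V) :
    ∃! P : Polynomial ℤ, ∀ q : ℕ, P.eval (q : ℤ) = (Nat.card (G.Coloring (Fin q)) : ℤ) := by
  classical
  have : Fintype V := Fintype.ofFinite V
  have hfin : Finite (Setoid V) :=
    Finite.of_injective (fun r : Setoid V => r.r) (fun a b h => Setoid.ext fun x y =>
      iff_of_eq (congrFun (congrFun h x) y))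
  let T := {r : Setoid V // ∀ x y, G.Adj x y → ¬ r x y}
  have : Fintype T := Fintype.ofFinite T
  have hval : ∀ q : ℕ, (∑ r : T, descPochhammer ℤ (Nat.card (Quotient r.1))).eval (q : ℤ) =
      (Nat.card (G.Coloring (Fin q)) : ℤ) := by
    intro q
    -- a colouring is the same as its kernel together with an injective map on the classes
    let e : G.Coloring (Fin q) ≃ Σ r : T, (Quotient r.1 ↪ Fin q) :=
      { toFun := fun C =>
          ⟨⟨Setoid.ker C, fun x y h h' => C.valid h h'⟩,
            ⟨Setoid.kerLift C, Setoid.kerLift_injective C⟩⟩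
        invFun := fun s => SimpleGraph.Coloring.mk (fun x => s.2 (Quotient.mk s.1.1 x))
          (fun {x y} h h' => s.1.2 x y h (Quotient.exact (s.2.injective h')))
        left_inv := fun C => by
          ext x
          rfl
        right_inv := by
          rintro ⟨⟨r, hr⟩, f⟩
          have hk : Setoid.ker (fun x => f (Quotient.mk r x)) = r := by
            ext x y
            constructor
            · intro h
              exact Quotient.exact (f.injective h)
            · intro h
              exact congrArg f (Quotient.sound h)
          refine Sigma.ext (Subtype.ext hk) ?_
          have key : ∀ (r' : Setoid V) (g : Quotient r' ↪ Fin q), r' = r →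
              (∀ x, g (Quotient.mk r' x) = f (Quotient.mk r x)) → HEq g f := by
            intro r' g h hg
            subst h
            refine heq_of_eq ?_
            ext z
            induction z using Quotient.inductionOn with
            | _ x => rw [hg x]
          exact key _ _ hk (fun x => rfl) }
    rw [Nat.card_congr e, Nat.card_sigma, Polynomial.eval_finsetSum]
    push_cast
    refine Finset.sum_congr rfl fun r _ => ?_
    have : Fintype (Quotient r.1) := Fintype.ofFinite _
    rw [descPochhammer_eval_eq_descFactorial, Nat.card_eq_fintype_card,
      Nat.card_eq_fintype_card, Fintype.card_embedding_eq, Fintype.card_fin]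
  refine ⟨_, hval, ?_⟩
  intro Q hQ
  refine Polynomial.eq_of_infinite_eval_eq _ _ ?_
  refine (Set.infinite_range_of_injective (Nat.cast_injective (R := ℤ))).mono ?_
  rintro _ ⟨q, rfl⟩
  exact (hQ q).trans (hval q).symm

/-- The chromatic polynomial of a finite simple graph: the integer polynomial whose value at
every natural number `q` is the number of proper vertex colourings with `q` colours. -/
noncomputable def SimpleGraph.chromaticPolynomial {V : Type*} [Finite V]
    (G : SimpleGraph V) : Polynomial ℤ :=
  G.existsUnique_chromaticPolynomial.choose

theorem SimpleGraph.eval_chromaticPolynomial {V : Type*} [Finite V]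
    (G : SimpleGraph V) (q : ℕ) :
    G.chromaticPolynomial.eval (q : ℤ) = (Nat.card (G.Coloring (Fin q)) : ℤ) :=
  G.existsUnique_chromaticPolynomial.choose_spec.1 q

/-- The complex number `z` is a chromatic root of the finite simple graph `G`. -/
def SimpleGraph.IsChromaticRootOf {V : Type*} [Finite V] (G : SimpleGraph V) (z : ℂ) : Prop :=
  Polynomial.aeval z G.chromaticPolynomial = 0

/-- The complex number `z` is a chromatic root, that is, a chromatic root of some finite
simple graph. -/
def IsChromaticRoot (z : ℂ) : Prop :=
  ∃ (N : ℕ) (G : SimpleGraph (Fin N)), G.IsChromaticRootOf z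

/-- The vertices of a generalised theta graph whose paths have lengths `m i`: the two end
vertices, and `m i - 1` inner vertices on the `i`-th path. -/
abbrev ThetaVertex {n : ℕ} (m : Fin n → ℕ) : Type :=
  Fin 2 ⊕ (Σ i : Fin n, Fin (m i - 1))

/-- The vertex in position `j` on the `i`-th path, for `0 ≤ j ≤ m i`: position `0` is the first
end vertex, position `m i` is the second one, and the others are the inner vertices in order. -/
def thetaPathVertex {n : ℕ} (m : Fin n → ℕ) (i : Fin n) (j : ℕ) : ThetaVertex m :=
  if j = 0 then Sum.inl 0
  else if h : j - 1 < m i - 1 then Sum.inr ⟨i, ⟨j - 1, h⟩⟩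
  else Sum.inl 1

/-- The generalised theta graph with path lengths `m i` (all at least `1`): two distinct
vertices joined by otherwise disjoint paths of lengths `m i`. Its edges join the vertices in
consecutive positions on a path. (Several paths of length `1` give one and the same edge.) -/
def genThetaGraph {n : ℕ} (m : Fin n → ℕ) : SimpleGraph (ThetaVertex m) :=
  SimpleGraph.fromRel fun x y =>
    ∃ (i : Fin n) (j : ℕ), j < m i ∧ x = thetaPathVertex m i j ∧ y = thetaPathVertex m i (j + 1)

/-! Replace every vertex of the theta graph `G` except one end by a `p`-clique, giving `H`. Along a
path, the number of fillings depends only on whether the single end's colour occurs in the current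
clique, because that end is a single vertex. So two counts suffice, and they satisfy a linear
recursion (`card_disjointChain`). Its coefficients are a common factor `K` times `q - p`, `p`, `q -
2p`, which all scale by `p` when `q = pt`. Hence each step just multiplies the `p = 1` counts by
`Kp` (`pathCounts_mul`), by the same power in both states. Multiplying over the paths gives `X *
P_H(pX) = Q * P_G(X)`, and a nonzero root `α` of `P_G` makes `pα` a root of `P_H`. -/

open Polynomial

/-! ### Clique blow-ups and their colourings -/

namespace SimpleGraph

/-- Isomorphic finite graphs have the same chromatic polynomial. -/
theorem chromaticPolynomial_congr {V W : Type*} [Finite V] [Finite W] {G : SimpleGraph V}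
    {H : SimpleGraph W} (e : G ≃g H) : G.chromaticPolynomial = H.chromaticPolynomial := by
  refine G.existsUnique_chromaticPolynomial.unique G.eval_chromaticPolynomial fun q => ?_
  rw [H.eval_chromaticPolynomial, Nat.cast_inj]
  exact Nat.card_congr
    { toFun := fun C => C.comp e.toHom
      invFun := fun C => C.comp e.symm.toHom
      left_inv := fun C => by ext x; simp
      right_inv := fun C => by ext x; simp }

/-- The graph obtained from `G` by replacing each vertex `x` by a clique with `w x` vertices. -/
def cliqueBlowup {V : Type*} (G : SimpleGraph V) (w : V → ℕ) : SimpleGraph (Σ x, Fin (w x)) where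
  Adj s t := s ≠ t ∧ (s.1 = t.1 ∨ G.Adj s.1 t.1)
  symm := ⟨fun _ _ h => ⟨h.1.symm, h.2.imp Eq.symm fun h => h.symm⟩⟩
  loopless := ⟨fun _ h => h.1 rfl⟩

/-- Blowing up every vertex to a single vertex does not change the graph. -/
def cliqueBlowupIso {V : Type*} (G : SimpleGraph V) (w : V → ℕ) (hw : ∀ x, w x = 1) :
    G.cliqueBlowup w ≃g G where
  toFun := Sigma.fst
  invFun x := ⟨x, ⟨0, by simp [hw]⟩⟩
  left_inv := by
    rintro ⟨x, a, ha⟩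
    have := hw x
    simp only [Sigma.mk.injEq, heq_eq_eq, Fin.mk.injEq, true_and]
    omega
  right_inv _ := rfl
  map_rel_iff' := by
    rintro ⟨x, a, ha⟩ ⟨y, b, hb⟩
    simp only [Equiv.coe_fn_mk, cliqueBlowup]
    refine ⟨fun h => ⟨fun e => h.ne (congrArg Sigma.fst e), Or.inr h⟩, ?_⟩
    rintro ⟨hne, rfl | h⟩
    · refine absurd ?_ hne
      have := hw x
      simp only [Sigma.mk.injEq, heq_eq_eq, Fin.mk.injEq, true_and]
      omega
    · exact h

/-- A colouring of a blow-up assigns to every vertex `x` of the graph `w x` distinct colours in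
order, with disjoint sets of colours on adjacent vertices. -/
def cliqueBlowupColoringEquiv {V : Type*} (G : SimpleGraph V) (w : V → ℕ) (q : ℕ) :
    (G.cliqueBlowup w).Coloring (Fin q) ≃
      {f : ∀ x, Fin (w x) ↪ Fin q //
        ∀ x y, G.Adj x y → Disjoint (Set.range (f x)) (Set.range (f y))} where
  toFun C := ⟨fun x => ⟨fun a => C ⟨x, a⟩, fun a b h => by
      by_contra hab
      exact C.valid (v := ⟨x, a⟩) (w := ⟨x, b⟩)
        ⟨by simpa using hab, Or.inl rfl⟩ h⟩, fun x y hxy => by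
      rw [Set.disjoint_left]
      rintro _ ⟨a, rfl⟩ ⟨b, hb⟩
      exact C.valid (v := ⟨x, a⟩) (w := ⟨y, b⟩)
        ⟨fun e => hxy.ne (congrArg Sigma.fst e), Or.inr hxy⟩ hb.symm⟩
  invFun f := Coloring.mk (fun s => f.1 s.1 s.2) (by
    rintro ⟨x, a⟩ ⟨y, b⟩ ⟨hne, h | h⟩ heq
    · dsimp only at h
      subst h
      exact hne (congrArg (Sigma.mk x) ((f.1 x).injective heq))
    · exact Set.disjoint_left.1 (f.2 x y h) ⟨a, rfl⟩ ⟨b, heq.symm⟩)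
  left_inv C := by ext; rfl
  right_inv f := rfl

end SimpleGraph

/-! ### Chains of consecutively disjoint sets -/

section Walks

variable {Ω : Type*} {β : Type*} (ρ : Ω → Set β)

/-- In the sequence `s, t 0, …, t (k - 1)` followed by the set `c`, consecutive terms are
disjoint. -/
def DisjointChain : (k : ℕ) → Ω → (Fin k → Ω) → Set β → Prop
  | 0, s, _, c => Disjoint (ρ s) c
  | k + 1, s, t, c => Disjoint (ρ s) (ρ (t 0)) ∧ DisjointChain k (t 0) (Fin.tail t) c

/-- The set in position `j` of the sequence `s, t 0, …, t (k - 1), c`. -/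
def chainTerm {k : ℕ} (s : Ω) (t : Fin k → Ω) (c : Set β) (j : ℕ) : Set β :=
  if j = 0 then ρ s else if h : j - 1 < k then ρ (t ⟨j - 1, h⟩) else c

theorem chainTerm_succ {k : ℕ} (s : Ω) (t : Fin (k + 1) → Ω) (c : Set β) (j : ℕ) :
    chainTerm ρ s t c (j + 1) = chainTerm ρ (t 0) (Fin.tail t) c j := by
  cases j with
  | zero => simp [chainTerm]
  | succ j => simp [chainTerm, Fin.tail]

theorem disjointChain_iff {k : ℕ} (s : Ω) (t : Fin k → Ω) (c : Set β) :
    DisjointChain ρ k s t c ↔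
      ∀ j < k + 1, Disjoint (chainTerm ρ s t c j) (chainTerm ρ s t c (j + 1)) := by
  induction k generalizing s with
  | zero => simp [DisjointChain, chainTerm]
  | succ k ih =>
    rw [DisjointChain, ih, Nat.forall_lt_succ_left (n := k + 1)]
    simp only [chainTerm_succ ρ s]
    rfl

open Classical in
theorem card_disjointChain_succ [Fintype Ω] (k : ℕ) (s : Ω) (c : Set β) :
    Nat.card {t : Fin (k + 1) → Ω // DisjointChain ρ (k + 1) s t c} =
      ∑ u : Ω, if Disjoint (ρ s) (ρ u) then Nat.card {t : Fin k → Ω // DisjointChain ρ k u t c}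
        else 0 := by
  let e : {t : Fin (k + 1) → Ω // DisjointChain ρ (k + 1) s t c} ≃
      Σ u : Ω, {t : Fin k → Ω // Disjoint (ρ s) (ρ u) ∧ DisjointChain ρ k u t c} :=
    { toFun := fun t => ⟨t.1 0, Fin.tail t.1, t.2⟩
      invFun := fun x => ⟨Fin.cons x.1 x.2.1, by simpa [DisjointChain] using x.2.2⟩
      left_inv := fun t => by simp
      right_inv := fun x => rfl }
  rw [Nat.card_congr e, Nat.card_sigma]
  refine Finset.sum_congr rfl fun u _ => ?_
  split_ifs with h <;> simp [h]

end Walks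

/-! ### The two-state recursion along a path -/

/-- The numbers of ways to fill in a path of `k` cliques of size `p` between a clique of size `p`
with given colours and a single vertex with given colour, according to whether the colour of
the latter occurs in the former or not. Here `q` is the number of colours and `K` stands for a
falling factorial. -/
def pathCounts (K p q : ℤ) : ℕ → ℤ × ℤ
  | 0 => (0, 1)
  | k + 1 => (K * (q - p) * (pathCounts K p q k).2,
      K * (p * (pathCounts K p q k).1 + (q - 2 * p) * (pathCounts K p q k).2))

/-- Each coefficient of the recursion is homogeneous of degree one in `(p, q)` up to the factor `K`,
so `q = p * t` pulls out `K * p` per step. -/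
theorem pathCounts_mul (K p t : ℤ) (k : ℕ) :
    (pathCounts K p (p * t) k).1 = (K * p) ^ k * (pathCounts 1 1 t k).1 ∧
      (pathCounts K p (p * t) k).2 = (K * p) ^ k * (pathCounts 1 1 t k).2 := by
  induction k with
  | zero => simp [pathCounts]
  | succ k ih =>
    simp only [pathCounts, ih.1, ih.2]
    constructor <;> ring

open Classical in
/-- The number of injections of `Fin p` into `Fin q` that avoid a given finite set. -/
theorem card_embedding_disjoint (p q : ℕ) (A : Finset (Fin q)) :
    (Finset.univ.filter fun T : Fin p ↪ Fin q => Disjoint (A : Set (Fin q)) (Set.range T)).card =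
      (q - A.card).descFactorial p := by
  have e : {T : Fin p ↪ Fin q // Disjoint (A : Set (Fin q)) (Set.range T)} ≃
      (Fin p ↪ {x // x ∉ A}) :=
    { toFun := fun T => ⟨fun a => ⟨T.1 a, fun h => Set.disjoint_left.1 T.2 h ⟨a, rfl⟩⟩,
        fun a b h => T.1.injective (congrArg Subtype.val h)⟩
      invFun := fun T => ⟨T.trans (Function.Embedding.subtype _), by
        rw [Set.disjoint_left]
        rintro _ h ⟨a, rfl⟩
        exact (T a).2 h⟩
      left_inv := fun T => rfl
      right_inv := fun T => rfl }
  rw [← Fintype.card_subtype, Fintype.card_congr e, Fintype.card_embedding_eq, Fintype.card_fin,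
    Fintype.card_subtype_compl, Fintype.card_fin, Fintype.card_coe]

open Classical in
/-- A sum over the injections disjoint from `S` of a function of whether they avoid a colour. -/
theorem sum_embedding_disjoint {p q : ℕ} (hp : 1 ≤ p) (hq : 2 * p ≤ q) (S : Fin p ↪ Fin q)
    (c : Fin 1 ↪ Fin q) (a b : ℤ) :
    (∑ T : Fin p ↪ Fin q, if Disjoint (Set.range S) (Set.range T) then
      (if Disjoint (Set.range T) (Set.range c) then b else a) else 0) =
    if Disjoint (Set.range S) (Set.range c) then
      ((q - p - 1).descFactorial (p - 1) : ℤ) * (p * a + (q - 2 * p) * b)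
    else ((q - p - 1).descFactorial (p - 1) : ℤ) * (q - p) * b := by
  obtain ⟨p, rfl⟩ : ∃ r, p = r + 1 := ⟨p - 1, by omega⟩
  obtain ⟨r, rfl⟩ : ∃ r, q = 2 * (p + 1) + r := ⟨q - 2 * (p + 1), by omega⟩
  have hS := card_embedding_disjoint (p + 1) _ (Finset.univ.map S)
  have hSc := card_embedding_disjoint (p + 1) _ (Finset.univ.map S ∪ Finset.univ.map c)
  rw [Finset.card_map, Finset.card_univ, Fintype.card_fin,
    show 2 * (p + 1) + r - (p + 1) = (p + r) + 1 by omega, Nat.succ_descFactorial_succ] at hS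
  have hK : 2 * (p + 1) + r - (p + 1) - 1 = p + r := by omega
  rw [hK, Nat.add_sub_cancel]
  simp only [Finset.coe_map, Finset.coe_univ, Set.image_univ, Finset.coe_union,
    Set.disjoint_union_left] at hS hSc
  -- If the colour of `c` is not in `S`, count all `T` avoiding `S` with value `a`, then correct by
  -- `b - a` on those also avoiding `c`.
  split_ifs with h
  · rw [Finset.card_union_of_disjoint (by
      rw [← Finset.disjoint_coe]
      simpa only [Finset.coe_map, Finset.coe_univ, Set.image_univ] using h)] at hSc
    simp only [Finset.card_map, Finset.card_univ, Fintype.card_fin] at hSc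
    -- The last factor of the falling factorial is `r`, the original `q - 2p`; the rest is the same
    -- `K` as in `hS`.
    rw [← Nat.sub_sub, hK, Nat.descFactorial_succ, Nat.add_sub_cancel_left] at hSc
    have key : ∀ T : Fin (p + 1) ↪ Fin (2 * (p + 1) + r),
        (if Disjoint (Set.range S) (Set.range T) then
          (if Disjoint (Set.range T) (Set.range c) then b else a) else 0) =
        (if Disjoint (Set.range S) (Set.range T) then a else 0) +
        (if Disjoint (Set.range S) (Set.range T) ∧ Disjoint (Set.range c) (Set.range T)
          then b - a else 0) := by
      intro T
      rw [disjoint_comm (a := Set.range c)]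
      split_ifs <;> first | ring1 | tauto
    simp only [key]
    rw [Finset.sum_add_distrib, ← Finset.sum_filter, ← Finset.sum_filter, Finset.sum_const,
      Finset.sum_const, hS, hSc]
    simp only [nsmul_eq_mul]
    push_cast
    ring
  -- Here the colour of `c` lies in `S`, so any `T` avoiding `S` avoids it too.
  · have key : ∀ T : Fin (p + 1) ↪ Fin (2 * (p + 1) + r),
        (if Disjoint (Set.range S) (Set.range T) then
          (if Disjoint (Set.range T) (Set.range c) then b else a) else 0) =
        (if Disjoint (Set.range S) (Set.range T) then b else 0) := by
      intro T
      split_ifs with h1 h2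
      · rfl
      · refine absurd ?_ h2
        rw [Set.disjoint_left] at h1 ⊢
        rintro _ h3 ⟨i, rfl⟩
        refine h ?_
        rw [Set.disjoint_left]
        rintro _ h4 ⟨j, rfl⟩
        exact h1 (Subsingleton.elim j i ▸ h4) h3
      · rfl
    simp only [key]
    rw [← Finset.sum_filter, Finset.sum_const, hS]
    simp only [nsmul_eq_mul]
    push_cast
    ring

open Classical in
theorem card_disjointChain {p q : ℕ} (hp : 1 ≤ p) (hq : 2 * p ≤ q) (k : ℕ) (S : Fin p ↪ Fin q)
    (c : Fin 1 ↪ Fin q) :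
    (Nat.card {t : Fin k → (Fin p ↪ Fin q) //
      DisjointChain (fun T : Fin p ↪ Fin q => Set.range T) k S t (Set.range c)} : ℤ) =
    if Disjoint (Set.range S) (Set.range c) then
      (pathCounts ((q - p - 1).descFactorial (p - 1)) p q k).2
    else (pathCounts ((q - p - 1).descFactorial (p - 1)) p q k).1 := by
  induction k generalizing S with
  | zero =>
    simp only [DisjointChain, pathCounts]
    split_ifs with h <;> simp [h]
  | succ k ih =>
    rw [card_disjointChain_succ]
    push_cast
    simp only [ih]
    rw [sum_embedding_disjoint hp hq]
    rfl

/-! ### Theta graphs as bundles of chains -/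

/-- The clique sizes used for blowing up a theta graph: the second end vertex stays single. -/
def thetaWeight {n : ℕ} (m : Fin n → ℕ) (p : ℕ) : ThetaVertex m → ℕ :=
  Sum.elim ![p, 1] fun _ => p

theorem genThetaGraph_forall_adj {n : ℕ} (m : Fin n → ℕ) {β : Type*} (g : ThetaVertex m → Set β)
    (hg : ∀ i j, j < m i → thetaPathVertex m i j ≠ thetaPathVertex m i (j + 1)) :
    (∀ x y, (genThetaGraph m).Adj x y → Disjoint (g x) (g y)) ↔
      ∀ i j, j < m i →
        Disjoint (g (thetaPathVertex m i j)) (g (thetaPathVertex m i (j + 1))) := by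
  constructor
  · intro h i j hj
    refine h _ _ ?_
    rw [genThetaGraph, SimpleGraph.fromRel_adj]
    exact ⟨fun e => hg i j hj e, Or.inl ⟨i, j, hj, rfl, rfl⟩⟩
  · intro h x y hxy
    rw [genThetaGraph, SimpleGraph.fromRel_adj] at hxy
    obtain ⟨-, ⟨i, j, hj, rfl, rfl⟩ | ⟨i, j, hj, rfl, rfl⟩⟩ := hxy
    · exact h i j hj
    · exact (h i j hj).symm

theorem thetaPathVertex_ne_succ {n : ℕ} (m : Fin n → ℕ) (i : Fin n) (j : ℕ) (hj : j < m i) :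
    thetaPathVertex m i j ≠ thetaPathVertex m i (j + 1) := by
  unfold thetaPathVertex
  split_ifs <;> simp <;> omega

theorem thetaPathVertex_chainTerm {n : ℕ} (m : Fin n → ℕ) (p q : ℕ)
    (f : ∀ x, Fin (thetaWeight m p x) ↪ Fin q) (i : Fin n) (j : ℕ) :
    Set.range (f (thetaPathVertex m i j)) =
      chainTerm (fun T : Fin p ↪ Fin q => Set.range T) (f (Sum.inl 0))
        (fun a : Fin (m i - 1) => f (Sum.inr ⟨i, a⟩)) (Set.range (f (Sum.inl 1))) j := by
  unfold thetaPathVertex chainTerm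
  by_cases h : j = 0
  · rw [if_pos h]
    simp only [h, if_true]
    rfl
  · rw [if_neg h]
    simp only [h, if_false]
    by_cases h' : j - 1 < m i - 1
    · rw [dif_pos h', dif_pos h']
      rfl
    · rw [dif_neg h', dif_neg h']

/-- Multicolourings of a theta graph, split into paths. -/
def thetaMulticoloringEquiv {n : ℕ} (m : Fin n → ℕ) (hm : ∀ i, 1 ≤ m i) (p q : ℕ) :
    {f : ∀ x, Fin (thetaWeight m p x) ↪ Fin q //
      ∀ x y, (genThetaGraph m).Adj x y → Disjoint (Set.range (f x)) (Set.range (f y))} ≃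
    Σ S : Fin p ↪ Fin q, Σ c : Fin 1 ↪ Fin q, ∀ i : Fin n,
      {t : Fin (m i - 1) → (Fin p ↪ Fin q) //
        DisjointChain (fun T : Fin p ↪ Fin q => Set.range T) (m i - 1) S t (Set.range c)} :=
  have key : ∀ f : ∀ x, Fin (thetaWeight m p x) ↪ Fin q,
      (∀ x y, (genThetaGraph m).Adj x y → Disjoint (Set.range (f x)) (Set.range (f y))) ↔
      ∀ i, DisjointChain (fun T : Fin p ↪ Fin q => Set.range T) (m i - 1) (f (Sum.inl 0))
        (fun a : Fin (m i - 1) => f (Sum.inr ⟨i, a⟩)) (Set.range (f (Sum.inl 1))) := by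
    intro f
    rw [genThetaGraph_forall_adj m (fun x => Set.range (f x)) (thetaPathVertex_ne_succ m)]
    refine forall_congr' fun i => ?_
    have h := disjointChain_iff (fun T : Fin p ↪ Fin q => Set.range T) (k := m i - 1)
      (f (Sum.inl 0)) (fun a => f (Sum.inr ⟨i, a⟩)) (Set.range (f (Sum.inl 1)))
    rw [Nat.sub_add_cancel (hm i)] at h
    exact Iff.trans (forall₂_congr fun j _ => iff_of_eq (congrArg₂ Disjoint
      (thetaPathVertex_chainTerm m p q f i j) (thetaPathVertex_chainTerm m p q f i (j + 1)))) h.symm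
  { toFun := fun f => ⟨f.1 (Sum.inl 0), f.1 (Sum.inl 1), fun i =>
      ⟨fun a => f.1 (Sum.inr ⟨i, a⟩), (key f.1).1 f.2 i⟩⟩
    invFun := fun x => ⟨fun v => match v with
        | Sum.inl 0 => x.1
        | Sum.inl 1 => x.2.1
        | Sum.inr s => (x.2.2 s.1).1 s.2, (key _).2 fun i => (x.2.2 i).2⟩
    left_inv := fun f => by
      ext v : 2
      match v with
      | Sum.inl 0 => rfl
      | Sum.inl 1 => rfl
      | Sum.inr s => rfl
    right_inv := fun x => rfl }

/-- The number of colourings of a theta graph whose vertices except one end are blown up. -/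
theorem eval_chromaticPolynomial_thetaBlowup {n : ℕ} (m : Fin n → ℕ) (hm : ∀ i, 1 ≤ m i)
    {p q : ℕ} (hp : 1 ≤ p) (hq : 2 * p ≤ q) :
    ((genThetaGraph m).cliqueBlowup (thetaWeight m p)).chromaticPolynomial.eval (q : ℤ) =
      (q.descFactorial p : ℤ) *
        (p * ∏ i, (pathCounts ((q - p - 1).descFactorial (p - 1)) p q (m i - 1)).1 +
        (q - p) * ∏ i, (pathCounts ((q - p - 1).descFactorial (p - 1)) p q (m i - 1)).2) := by
  classical
  rw [SimpleGraph.eval_chromaticPolynomial,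
    Nat.card_congr (SimpleGraph.cliqueBlowupColoringEquiv _ _ _),
    Nat.card_congr (thetaMulticoloringEquiv m hm p q), Nat.card_sigma]
  simp only [Nat.card_sigma, Nat.card_pi]
  push_cast
  simp only [card_disjointChain hp hq]
  set E := ∏ i, (pathCounts ((q - p - 1).descFactorial (p - 1)) p q (m i - 1)).1
  set D := ∏ i, (pathCounts ((q - p - 1).descFactorial (p - 1)) p q (m i - 1)).2
  have inner : ∀ S : Fin p ↪ Fin q, (∑ c : Fin 1 ↪ Fin q, ∏ i,
      if Disjoint (Set.range S) (Set.range c) then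
        (pathCounts ((q - p - 1).descFactorial (p - 1)) p q (m i - 1)).2
      else (pathCounts ((q - p - 1).descFactorial (p - 1)) p q (m i - 1)).1) =
      p * E + (q - p) * D := by
    intro S
    have hS := card_embedding_disjoint 1 q (Finset.univ.map S)
    simp only [Finset.coe_map, Finset.coe_univ, Set.image_univ, Finset.card_map,
      Finset.card_univ, Fintype.card_fin, Nat.descFactorial_one] at hS
    -- All paths share the ends, hence the same state: the product is `D` or `E`, never mixed.
    have split : ∀ c : Fin 1 ↪ Fin q, (∏ i, if Disjoint (Set.range S) (Set.range c) then
        (pathCounts ((q - p - 1).descFactorial (p - 1)) p q (m i - 1)).2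
      else (pathCounts ((q - p - 1).descFactorial (p - 1)) p q (m i - 1)).1) =
        E + if Disjoint (Set.range S) (Set.range c) then D - E else 0 := by
      intro c
      split_ifs
      · exact (add_sub_cancel E D).symm
      · exact (add_zero E).symm
    simp only [split]
    rw [Finset.sum_add_distrib, ← Finset.sum_filter, Finset.sum_const, Finset.sum_const, hS,
      Finset.card_univ, Fintype.card_embedding_eq, Fintype.card_fin, Fintype.card_fin,
      Nat.descFactorial_one, nsmul_eq_mul, nsmul_eq_mul, Nat.cast_sub (by omega)]
    ring
  simp only [inner]
  rw [Finset.sum_const, Finset.card_univ, Fintype.card_embedding_eq, Fintype.card_fin,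
    Fintype.card_fin, nsmul_eq_mul]

/-- Up to a factor, the chromatic polynomial of the blown up theta graph at `p * X` is that of the
theta graph. -/
theorem exists_chromaticPolynomial_thetaBlowup_comp {n : ℕ} (m : Fin n → ℕ) (hm : ∀ i, 1 ≤ m i)
    {p : ℕ} (hp : 1 ≤ p) :
    ∃ Q : ℤ[X], X *
      ((genThetaGraph m).cliqueBlowup (thetaWeight m p)).chromaticPolynomial.comp ((p : ℤ[X]) * X) =
        Q * (genThetaGraph m).chromaticPolynomial := by
  -- The factors are the colourings of the blown-up end, a `p` from the final bracket, and one `K *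
  -- p` per inner vertex.
  refine ⟨(descPochhammer ℤ p).comp ((p : ℤ[X]) * X) * (p : ℤ[X]) *
    ((descPochhammer ℤ (p - 1)).comp ((p : ℤ[X]) * X - (p : ℤ[X]) - 1) * (p : ℤ[X])) ^
      ∑ i, (m i - 1), ?_⟩
  -- Sampling at `t ≥ 2` ensures `2 * p ≤ p * t`, and `2 ≤ t` for the case `p = 1`.
  have hinf : (Set.range fun k : ℕ => ((k + 2 : ℕ) : ℤ)).Infinite :=
    Set.infinite_range_of_injective fun a b h => by simpa using h
  refine Polynomial.eq_of_infinite_eval_eq _ _ (hinf.mono ?_)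
  rintro _ ⟨k, rfl⟩
  rw [Set.mem_ofPred_eq]
  dsimp only
  generalize ht : k + 2 = t
  have h2 : 2 ≤ t := by omega
  have hpt : 2 * p ≤ p * t := by nlinarith
  have hK : (descPochhammer ℤ (p - 1)).eval ((p : ℤ) * t - p - 1) =
      ((p * t - p - 1).descFactorial (p - 1) : ℤ) := by
    rw [← descPochhammer_eval_eq_descFactorial, Nat.cast_sub (by omega), Nat.cast_sub (by omega)]
    push_cast
    rfl
  have hd : (descPochhammer ℤ p).eval ((p : ℤ) * t) = ((p * t).descFactorial p : ℤ) := by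
    rw [← descPochhammer_eval_eq_descFactorial, Nat.cast_mul]
  -- The case `p = 1` of the blow-up formula computes the theta graph itself.
  have hG := eval_chromaticPolynomial_thetaBlowup m hm le_rfl (q := t) (by omega)
  rw [SimpleGraph.chromaticPolynomial_congr (SimpleGraph.cliqueBlowupIso _ _ (by
    rintro (x | x)
    · fin_cases x <;> rfl
    · rfl))] at hG
  have hH := eval_chromaticPolynomial_thetaBlowup m hm hp hpt
  simp only [Nat.sub_self, Nat.descFactorial_zero, Nat.descFactorial_one, Nat.cast_one,
    one_mul] at hG
  simp only [Nat.cast_mul, (pathCounts_mul _ _ _ _).1, (pathCounts_mul _ _ _ _).2,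
    Finset.prod_mul_distrib, Finset.prod_pow_eq_pow_sum] at hH
  simp only [eval_mul, eval_comp, eval_X, eval_natCast, eval_pow, eval_sub, eval_one, hK, hd,
    hG, hH]
  ring

/-! ### Passing to chromatic roots -/

theorem isChromaticRoot_of_isChromaticRootOf {V : Type*} [Finite V] (G : SimpleGraph V) {z : ℂ}
    (h : G.IsChromaticRootOf z) : IsChromaticRoot z := by
  have : Fintype V := Fintype.ofFinite V
  refine ⟨Fintype.card V, G.overFin rfl, ?_⟩
  rw [SimpleGraph.IsChromaticRootOf,
    ← SimpleGraph.chromaticPolynomial_congr (G.overFinIso rfl)]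
  exact h

theorem isChromaticRoot_zero : IsChromaticRoot 0 := by
  refine ⟨1, ⊥, ?_⟩
  have h := (⊥ : SimpleGraph (Fin 1)).eval_chromaticPolynomial 0
  have : IsEmpty ((⊥ : SimpleGraph (Fin 1)).Coloring (Fin 0)) := ⟨fun C => (C 0).elim0⟩
  rw [Nat.card_of_isEmpty, Nat.cast_zero, ← coeff_zero_eq_eval_zero] at h
  rw [SimpleGraph.IsChromaticRootOf, ← coeff_zero_eq_aeval_zero', h, map_zero]

theorem mainTheorem4 {n : ℕ} (m : Fin n → ℕ) (hm : ∀ i, 1 ≤ m i) (α : ℂ)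
    (hα : (genThetaGraph m).IsChromaticRootOf α) (hint : ∀ z : ℤ, α ≠ (z : ℂ)) (p : ℕ) :
    IsChromaticRoot ((p : ℂ) * α) := by
  obtain rfl | hp := Nat.eq_zero_or_pos p
  · simpa using isChromaticRoot_zero
  obtain ⟨Q, hQ⟩ := exists_chromaticPolynomial_thetaBlowup_comp m hm hp
  refine isChromaticRoot_of_isChromaticRootOf
    ((genThetaGraph m).cliqueBlowup (thetaWeight m p)) ?_
  have h := congrArg (aeval α) hQ
  rw [map_mul, map_mul, aeval_X, aeval_comp, map_mul, map_natCast, aeval_X,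
    show aeval α (genThetaGraph m).chromaticPolynomial = 0 from hα, mul_zero] at h
  -- Non-integrality gives `α ≠ 0`, which cancels the factor `X`.
  exact (mul_eq_zero.1 h).resolve_left (by simpa using hint 0)
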